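/- Let $G$ be a second-countable, locally compact (Hausdorff), non-compact group with left Haar measure $\mu$, let $S\subset G$, $1\le p<\infty$, and let $\Gamma\subset\mathbb{C}$ be such that $\Gamma\setminus\{0\}\neq\emptyset$. Let $\omega:G\to(0,\infty)$ be a locally $p$-integrable function (i.e. $\int_K\omega^p\,d\mu<\infty$ for every compact $K\subset G$) that is $S$-admissible, i.e. $\operatorname{ess\,sup}_{t\in G}\omega(st)/\omega(t)<\infty$ for every $s\in S$. Let $L^p(G,\omega)$ be the space of measurable $f:G\to\mathbb{C}$ (modulo equality almost everywhere) with $\|f\|_{p,\omega}=\left(\int_G|f|^p\omega^p\,d\mu\right)^{1/p}<\infty$; for $s\in S$, the translation $(T_sf)(t)=f(s^{-1}t)$ maps it into itself. A vector $f\in L^p(G,\omega)$ is called $(\Gamma,S)$-dense if $\{\lambda T_sf:\lambda\in\Gamma,\ s\in S\}$ is dense in $L^p(G,\omega)$. For $K\subset G$ compact write $\|\omega\|_{p,K}=\left(\int_K\omega^p\,d\mu\right)^{1/p}$. If the subgroup of $G$ generated by $S$ is abelian, then the following conditions are equivalent: (1) There is a $(\Gamma,S)$-dense vector in $L^p(G,\omega)$.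 (2) For every compact $F\subset G$ and every $\varepsilon>0$ there are $s\in S$, $\lambda\in\Gamma\setminus\{0\}$ and a compact $E\subset F$ such that $\mu(F\setminus E)<\varepsilon$, $$|\lambda|\operatorname*{ess\,sup}_{t\in E}\omega(st)<\varepsilon\quad\text{and}\quad\frac1{|\lambda|}\operatorname*{ess\,sup}_{t\in E}\omega(s^{-1}t)<\varepsilon .$$ (3) For every compact $F\subset G$ and every $\varepsilon>0$ there are $s\in S$, $\lambda\in\Gamma\setminus\{0\}$ and a compact $E\subset F$ such that $\mu(F\setminus E)<\varepsilon$, $$|\lambda|\,\|\omega\|_{p,sE}<\varepsilon\quad\text{and}\quad\frac1{|\lambda|}\,\|\omega\|_{p,s^{-1}E}<\varepsilon .$$ (The essential supremum over a null set is $0$.) -/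

import Mathlib

open MeasureTheory
open scoped ENNReal Pointwise

noncomputable section

namespace WeightedGroup

variable {G : Type*} [Group G] [TopologicalSpace G] [MeasurableSpace G]

/-- A weight: a (strictly) positive, locally `p`-integrable function, i.e. one that lies in `L^p(K)`
for every compact set `K`. -/
structure IsWeight (p : ℝ≥0∞) (μ : Measure G) (ω : G → ℝ) : Prop where
  pos : ∀ t, 0 < ω t
  memLp : ∀ K : Set G, IsCompact K → MemLp ω p (μ.restrict K)

/-- `M(s) = ess sup_{t ∈ G} ω(st) / ω(t)`, with values in `[0, ∞]`. -/
def transBound (μ : Measure G) (ω : G → ℝ) (s : G) : ℝ≥0∞ :=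
  essSup (fun t => ENNReal.ofReal (ω (s * t) / ω t)) μ

/-- `ω` is `S`-admissible: `M(s) < ∞` for all `s ∈ S`. -/
def IsAdmissible (μ : Measure G) (S : Set G) (ω : G → ℝ) : Prop :=
  ∀ s ∈ S, transBound μ ω s < ∞

/-- The measure `ω^p dμ`. -/
def weightedMeasure (p : ℝ≥0∞) (μ : Measure G) (ω : G → ℝ) : Measure G :=
  μ.withDensity (fun t => ENNReal.ofReal (ω t) ^ p.toReal)

/-- The weighted space `L^p(G, ω)` of complex functions (modulo equality almost everywhere), with
norm `(∫ |f|^p ω^p dμ)^{1/p}`. -/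
abbrev WeightedLp (p : ℝ≥0∞) (μ : Measure G) (ω : G → ℝ) : Type _ :=
  Lp ℂ p (weightedMeasure p μ ω)

/-- Left translation of functions: `(T_s f)(t) = f(s⁻¹ t)`. -/
def translate (s : G) (f : G → ℂ) : G → ℂ := fun t => f (s⁻¹ * t)

/-- The `(Γ, S)`-orbit `{λ T_s f : λ ∈ Γ, s ∈ S}` of `f` in `L^p(G, ω)`. (If `ω` is an `S`-admissible
weight, every `λ T_s f` with `s ∈ S` is an element of `L^p(G, ω)`.) -/
def orbit (Γ : Set ℂ) (S : Set G) (p : ℝ≥0∞) (μ : Measure G) (ω : G → ℝ)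
    (f : WeightedLp p μ ω) : Set (WeightedLp p μ ω) :=
  {h | ∃ c ∈ Γ, ∃ s ∈ S, (h : G → ℂ) =ᵐ[μ] fun t => c * translate s f t}

/-- `f` is `(Γ, S)`-dense: its `(Γ, S)`-orbit is dense in `L^p(G, ω)`. -/
def IsDenseVector (Γ : Set ℂ) (S : Set G) (p : ℝ≥0∞) [Fact (1 ≤ p)] (μ : Measure G) (ω : G → ℝ)
    (f : WeightedLp p μ ω) : Prop :=
  Dense (orbit Γ S p μ ω f)

/-- `ess sup_{t ∈ E} ω(st)`, with values in `[0, ∞]` (it is `0` if `E` is a null set). -/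
def essSupOn (μ : Measure G) (ω : G → ℝ) (s : G) (E : Set G) : ℝ≥0∞ :=
  essSup (fun t => ENNReal.ofReal (ω (s * t))) (μ.restrict E)

/-- The local `p`-norm `‖ω‖_{p,K} = (∫_K |ω|^p dμ)^{1/p}`, with values in `[0, ∞]`. -/
def localNorm (p : ℝ≥0∞) (μ : Measure G) (ω : G → ℝ) (K : Set G) : ℝ≥0∞ :=
  eLpNorm ω p (μ.restrict K)

end WeightedGroup

end

set_option linter.unusedSectionVars false

/-! The equivalence of (2) and (3) holds for each compact `F` separately. Hölder bounds the `p`-norm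
over `sE` by the essential supremum times `μ(F)^{1/p}`. Conversely, a function with small `p`-norm
on `F` is uniformly small off a set of small measure (Chebyshev), and inner regularity provides a
compact set avoiding it.

For (3) ⇒ (1), the maps `λ T_s` form a transitive family on a separable Banach space, so Baire's
theorem gives a dense orbit. Transitivity is witnessed by `h = 1_E u' + λ⁻¹ T_{s⁻¹}(1_E v')` with
`u'`, `v'` compactly supported: (3) makes the second term small, and in `λ T_s h = λ T_s(1_E u') +
1_E v'` it makes the first term small.

For (1) ⇒ (3), commutativity turns a dense vector into some `h` close to `1_F` with `λ T_s h` close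
to `1_{F₂}`, where `F₂ ⊇ F` is compact and much larger in measure; it exists because `μ(G) = ∞`. The
gap in measure forces `sF ∩ F₂ = ∅` (`exists_compact_of_approx`). Hence on `sE`, where `1_{F₂} = 0`,
the whole of `λ T_s h` is error, yet it has modulus about `|λ|`; on `s⁻¹E` the same holds for `h`,
with `1/|λ|`. -/

namespace WeightedGroup

/-! ### Absolute continuity, Chebyshev and inner regularity -/

section General

variable {X : Type*} [MeasurableSpace X]

theorem exists_pos_forall_measure_lt {ρ ν : Measure X} [IsFiniteMeasure ρ] [SigmaFinite ν]
    (h : ρ ≪ ν) {ε : ℝ≥0∞} (hε : ε ≠ 0) : ∃ δ > 0, ∀ A, ν A < δ → ρ A < ε := by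
  obtain ⟨δ, hδ, H⟩ := exists_pos_setLIntegral_lt_of_measure_lt
    (Measure.lintegral_rnDeriv_lt_top ρ ν).ne hε
  refine ⟨δ, hδ, fun A hA => ?_⟩
  have := H A hA
  rwa [← withDensity_apply', Measure.withDensity_rnDeriv_eq _ _ h] at this

/-- Exceptional sets come from functions that are only a.e. measurable, so `N` is arbitrary and is
replaced by a measurable hull of `F ∩ N`. -/
theorem exists_isCompact_disjoint [TopologicalSpace X] [T2Space X] [BorelSpace X] (μ : Measure X)
    [IsFiniteMeasureOnCompacts μ] [μ.InnerRegularCompactLTTop] {F N : Set X} (hF : IsCompact F)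
    {ε : ℝ≥0∞} (hN : μ (F ∩ N) < ε) :
    ∃ E ⊆ F, IsCompact E ∧ Disjoint E N ∧ μ (F \ E) < ε := by
  set A := F \ toMeasurable μ (F ∩ N)
  have hA : MeasurableSet A := hF.measurableSet.diff (measurableSet_toMeasurable _ _)
  have hAf : μ A ≠ ∞ := ((measure_mono Set.sdiff_subset).trans_lt hF.measure_lt_top).ne
  obtain ⟨E, hEA, hE, hlt⟩ := hA.exists_isCompact_sdiff_lt hAf (tsub_pos_of_lt hN).ne'
  refine ⟨E, hEA.trans Set.sdiff_subset, hE, ?_, ?_⟩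
  · rw [Set.disjoint_left]
    intro t htE htN
    exact (hEA htE).2 (subset_toMeasurable _ _ ⟨(hEA htE).1, htN⟩)
  · have hsub : F \ E ⊆ toMeasurable μ (F ∩ N) ∪ (A \ E) := by
      intro t ht
      by_cases h : t ∈ toMeasurable μ (F ∩ N)
      · exact Or.inl h
      · exact Or.inr ⟨⟨ht.1, h⟩, ht.2⟩
    calc μ (F \ E) ≤ μ (F ∩ N) + μ (A \ E) := by
          refine (measure_mono hsub).trans ((measure_union_le _ _).trans ?_)
          rw [measure_toMeasurable]
      _ < μ (F ∩ N) + (ε - μ (F ∩ N)) := ENNReal.add_lt_add_left (hN.trans_le le_top).ne hlt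
      _ = ε := add_tsub_cancel_of_le hN.le

/-- Chebyshev makes the set small for `ν`, and absolute continuity transfers this to `ρ`. The main
use has `ν = ω^p dμ` and `ρ` the restriction of `μ` to a compact set. -/
theorem exists_pos_forall_measure_norm_ge_lt {ρ ν : Measure X} [IsFiniteMeasure ρ] [SigmaFinite ν]
    (h : ρ ≪ ν) {p : ℝ≥0∞} (hp0 : p ≠ 0) (hp : p ≠ ∞) {η : ℝ} (hη : 0 < η) {ε : ℝ≥0∞}
    (hε : ε ≠ 0) : ∃ δ > 0, ∀ g : X → ℂ, AEStronglyMeasurable g ν → eLpNorm g p ν < δ →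
      ρ {t | η ≤ ‖g t‖} < ε := by
  obtain ⟨δ, hδ, H⟩ := exists_pos_forall_measure_lt h hε
  have hpp := ENNReal.toReal_pos hp0 hp
  have hη' : ENNReal.ofReal η ≠ 0 := by simpa using hη
  refine ⟨ENNReal.ofReal η * δ ^ (1 / p.toReal), ?_, fun g hg hlt => H _ ?_⟩
  · refine pos_iff_ne_zero.2 (mul_ne_zero hη' ?_)
    exact (ENNReal.rpow_pos_of_nonneg hδ (by positivity)).ne'
  · have hset : {t | η ≤ ‖g t‖} = {t | ENNReal.ofReal η ≤ ‖g t‖ₑ} := by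
      ext t
      simp only [Set.mem_ofPred_eq]
      rw [← ofReal_norm, ENNReal.ofReal_le_ofReal_iff (norm_nonneg _)]
    rw [hset]
    refine (meas_ge_le_mul_pow_eLpNorm_enorm ν hp0 hp hg hη' (by simp)).trans_lt ?_
    rw [← ENNReal.mul_rpow_of_nonneg _ _ hpp.le]
    have h1 : (ENNReal.ofReal η)⁻¹ * eLpNorm g p ν < δ ^ (1 / p.toReal) := by
      rw [mul_comm, ← div_eq_mul_inv]
      refine ENNReal.div_lt_of_lt_mul' ?_
      exact hlt
    calc _ < (δ ^ (1 / p.toReal)) ^ p.toReal := ENNReal.rpow_lt_rpow h1 hpp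
      _ = δ := by rw [← ENNReal.rpow_mul, one_div_mul_cancel hpp.ne', ENNReal.rpow_one]

end General

/-! ### The weighted measure and the translation operators -/

section Weight

variable {G : Type*} [Group G] [TopologicalSpace G] [MeasurableSpace G]
  {μ : Measure G} {p : ℝ≥0∞} {ω : G → ℝ}

theorem IsWeight.aemeasurable [SigmaCompactSpace G] (hω : IsWeight p μ ω) : AEMeasurable ω μ := by
  have h : AEMeasurable ω (μ.restrict (⋃ n, compactCovering G n)) :=
    aemeasurable_iUnion_iff.2 fun n =>
      (hω.memLp _ (isCompact_compactCovering G n)).aestronglyMeasurable.aemeasurable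
  rwa [iUnion_compactCovering, Measure.restrict_univ] at h

theorem weightedMeasure_absolutelyContinuous : weightedMeasure p μ ω ≪ μ :=
  withDensity_absolutelyContinuous _ _

theorem IsWeight.absolutelyContinuous [SigmaCompactSpace G] (hω : IsWeight p μ ω) :
    μ ≪ weightedMeasure p μ ω := by
  refine withDensity_absolutelyContinuous' ?_ (ae_of_all _ fun t => ?_)
  · exact (hω.aemeasurable.ennreal_ofReal).pow_const _
  · exact (ENNReal.rpow_pos (by simpa using hω.pos t) (by simp)).ne'

theorem IsWeight.ae_eq_iff [SigmaCompactSpace G] (hω : IsWeight p μ ω) {f g : G → ℂ} :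
    f =ᵐ[μ] g ↔ f =ᵐ[weightedMeasure p μ ω] g :=
  ⟨fun h => weightedMeasure_absolutelyContinuous.ae_eq h, fun h => hω.absolutelyContinuous.ae_eq h⟩

theorem IsWeight.localNorm_eq (hω : IsWeight p μ ω) (hp0 : p ≠ 0) (hp : p ≠ ∞) {A : Set G}
    (hA : MeasurableSet A) : localNorm p μ ω A = weightedMeasure p μ ω A ^ (1 / p.toReal) := by
  rw [localNorm, eLpNorm_eq_lintegral_rpow_enorm_toReal hp0 hp, weightedMeasure,
    withDensity_apply _ hA]
  simp_rw [fun t => Real.enorm_of_nonneg (hω.pos t).le]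

variable [BorelSpace G] [T2Space G]

theorem IsWeight.isFiniteMeasureOnCompacts (hω : IsWeight p μ ω) (hp0 : p ≠ 0) (hp : p ≠ ∞) :
    IsFiniteMeasureOnCompacts (weightedMeasure p μ ω) := by
  refine ⟨fun K hK => ?_⟩
  have h := (hω.memLp K hK).eLpNorm_lt_top
  change localNorm p μ ω K < ∞ at h
  rw [hω.localNorm_eq hp0 hp hK.measurableSet] at h
  by_contra hne
  rw [not_lt, top_le_iff] at hne
  rw [hne, ENNReal.top_rpow_of_pos (one_div_pos.2 (ENNReal.toReal_pos hp0 hp))] at h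
  exact lt_irrefl _ h

variable [IsTopologicalGroup G] [SecondCountableTopology G] [μ.IsMulLeftInvariant]

theorem localNorm_smul (s : G) (E : Set G) :
    localNorm p μ ω (s • E) = eLpNorm (fun t => ω (s * t)) p (μ.restrict E) := by
  have h := (measurePreserving_mul_left μ s).restrict_image_emb
    (measurableEmbedding_mulLeft s) E
  change eLpNorm ω p (μ.restrict ((fun t => s * t) '' E)) = _
  rw [← h.map_eq]
  exact (measurableEmbedding_mulLeft s).eLpNorm_map_measure

/-- After the substitution `t ↦ st` this is the pointwise bound `ω(st) ≤ M(s) ω(t)` a.e.; it yields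
`‖T_s‖ ≤ M(s)`. -/
theorem map_weightedMeasure_le (hω : IsWeight p μ ω) {s : G} (hs : transBound μ ω s < ∞) :
    (weightedMeasure p μ ω).map (fun t => s⁻¹ * t) ≤
      transBound μ ω s ^ p.toReal • weightedMeasure p μ ω := by
  refine Measure.le_iff.2 fun A hA => ?_
  have hm : Measurable fun t : G => s⁻¹ * t := measurable_const_mul _
  rw [Measure.map_apply hm hA, Measure.smul_apply, weightedMeasure, withDensity_apply _ (hm hA),
    withDensity_apply _ hA, smul_eq_mul,
    ← (measurePreserving_mul_left μ s).setLIntegral_comp_preimage_emb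
      (measurableEmbedding_mulLeft s), ← Set.preimage_comp,
    ← lintegral_const_mul' _ _ (by finiteness)]
  have hid : ((fun t : G => s⁻¹ * t) ∘ fun t => s * t) = id := by ext; simp
  rw [hid, Set.preimage_id]
  refine lintegral_mono_ae (ae_restrict_of_ae ?_)
  filter_upwards [ENNReal.ae_le_essSup (μ := μ) fun t => ENNReal.ofReal (ω (s * t) / ω t)] with t ht
  rw [← ENNReal.mul_rpow_of_nonneg _ _ ENNReal.toReal_nonneg]
  refine ENNReal.rpow_le_rpow ?_ ENNReal.toReal_nonneg
  calc ENNReal.ofReal (ω (s * t)) = ENNReal.ofReal (ω (s * t) / ω t) * ENNReal.ofReal (ω t) := by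
        rw [← ENNReal.ofReal_mul (div_nonneg (hω.pos _).le (hω.pos _).le),
          div_mul_cancel₀ _ (hω.pos t).ne']
    _ ≤ _ := by gcongr; exact ht

variable [SigmaCompactSpace G]

theorem translate_congr {s : G} {f g : G → ℂ} (h : f =ᵐ[μ] g) :
    translate s f =ᵐ[μ] translate s g :=
  (measurePreserving_mul_left μ s⁻¹).quasiMeasurePreserving.ae_eq_comp h

/-- Translation by an admissible element, as a bounded operator. -/
theorem exists_translateCLM [Fact (1 ≤ p)] (hp : p ≠ ∞) (hω : IsWeight p μ ω) {s : G}
    (hs : transBound μ ω s < ∞) :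
    ∃ T : WeightedLp p μ ω →L[ℂ] WeightedLp p μ ω, ∀ f, T f =ᵐ[μ] translate s f := by
  have hp0 : p ≠ 0 := (zero_lt_one.trans_le (Fact.out : 1 ≤ p)).ne'
  have hpp := ENNReal.toReal_pos hp0 hp
  set ν := weightedMeasure p μ ω with hν
  set M := transBound μ ω s with hM
  have hm : Measurable fun t : G => s⁻¹ * t := measurable_const_mul _
  have hle := map_weightedMeasure_le hω hs
  have hac : ν.map (fun t => s⁻¹ * t) ≪ ν := Measure.absolutelyContinuous_of_le_smul hle
  have hbound : ∀ f : WeightedLp p μ ω, eLpNorm (translate s f) p ν ≤ M * eLpNorm f p ν := by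
    intro f
    have hf := (Lp.aestronglyMeasurable f).mono_ac hac
    change eLpNorm (f ∘ fun t => s⁻¹ * t) p ν ≤ _
    rw [← eLpNorm_map_measure hf hm.aemeasurable]
    refine (eLpNorm_mono_measure _ hle).trans ?_
    rw [eLpNorm_smul_measure_of_ne_top hp, ← ENNReal.rpow_mul, smul_eq_mul, ENNReal.toReal_div,
      ENNReal.toReal_one, one_div, mul_inv_cancel₀ hpp.ne', ENNReal.rpow_one]
  have hmem : ∀ f : WeightedLp p μ ω, MemLp (translate s f) p ν := fun f =>
    ⟨((Lp.aestronglyMeasurable f).mono_ac hac).comp_measurable hm,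
      (hbound f).trans_lt (ENNReal.mul_lt_top hs (Lp.eLpNorm_lt_top f))⟩
  have hco : ∀ f, (hmem f).toLp _ =ᵐ[μ] translate s f := fun f =>
    hω.ae_eq_iff.2 (MemLp.coeFn_toLp _)
  let L : WeightedLp p μ ω →ₗ[ℂ] WeightedLp p μ ω :=
    { toFun := fun f => (hmem f).toLp _
      map_add' := fun f g => by
        refine Lp.ext (hω.ae_eq_iff.1 ?_)
        filter_upwards [hco (f + g), hω.ae_eq_iff.2 (Lp.coeFn_add ((hmem f).toLp _)
          ((hmem g).toLp _)), hco f, hco g,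
          translate_congr (s := s) (hω.ae_eq_iff.2 (Lp.coeFn_add f g))] with t h1 h2 h3 h4 h5
        rw [h1, h2, h5, Pi.add_apply, h3, h4]
        rfl
      map_smul' := fun c f => by
        refine Lp.ext (hω.ae_eq_iff.1 ?_)
        filter_upwards [hco (c • f), hω.ae_eq_iff.2 (Lp.coeFn_smul c ((hmem f).toLp _)), hco f,
          translate_congr (s := s) (hω.ae_eq_iff.2 (Lp.coeFn_smul c f))] with t h1 h2 h3 h5
        rw [RingHom.id_apply, h1, h2, h5, Pi.smul_apply, h3]
        rfl }
  refine ⟨L.mkContinuous M.toReal fun f => ?_, fun f => hco f⟩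
  change ‖(hmem f).toLp _‖ ≤ _
  rw [Lp.norm_toLp, Lp.norm_def, ← ENNReal.toReal_mul]
  exact ENNReal.toReal_mono (ENNReal.mul_ne_top hs.ne (Lp.eLpNorm_ne_top f)) (hbound f)

end Weight

theorem exists_pos_ofReal_le {δ : ℝ≥0∞} (hδ : 0 < δ) : ∃ r : ℝ, 0 < r ∧ ENNReal.ofReal r ≤ δ := by
  obtain ⟨r, hr, hlt⟩ := ENNReal.lt_iff_exists_nnreal_btwn.1 hδ
  exact ⟨r, by simpa using hr, by simpa using hlt.le⟩

/-! ### Comparison of the two conditions on the weight -/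

section Conditions

variable {G : Type*} [Group G] [TopologicalSpace G] [MeasurableSpace G]
  {μ : Measure G} {p : ℝ≥0∞} {ω : G → ℝ} [BorelSpace G] [T2Space G]
  [IsTopologicalGroup G] [SecondCountableTopology G] [μ.IsMulLeftInvariant]

theorem IsWeight.aemeasurable_mul_left [LocallyCompactSpace G] (hω : IsWeight p μ ω) (s : G) :
    AEMeasurable (fun t => ω (s * t)) μ :=
  hω.aemeasurable.comp_quasiMeasurePreserving
    (measurePreserving_mul_left μ s).quasiMeasurePreserving

theorem IsWeight.localNorm_smul_le [LocallyCompactSpace G] (hω : IsWeight p μ ω) (s : G)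
    {E F : Set G} (hEF : E ⊆ F) :
    localNorm p μ ω (s • E) ≤ essSupOn μ ω s E * μ F ^ (1 / p.toReal) := by
  have h := eLpNorm_le_eLpNorm_mul_rpow_measure_univ (μ := μ.restrict E) (le_top : p ≤ ∞)
    (hω.aemeasurable_mul_left s).aestronglyMeasurable.restrict
  rw [← localNorm_smul, Measure.restrict_apply_univ, eLpNorm_exponent_top, eLpNormEssSup] at h
  simp_rw [fun t => Real.enorm_of_nonneg (hω.pos (s * t)).le] at h
  simp only [ENNReal.toReal_top, div_zero, sub_zero] at h
  refine h.trans ?_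
  change essSupOn μ ω s E * _ ≤ _
  gcongr

theorem enorm_mul_localNorm_smul (s : G) (c : ℂ)
    {E F : Set G} (hE : MeasurableSet E) (hEF : E ⊆ F) :
    eLpNorm (E.indicator fun t => c * (ω (s * t) : ℂ)) p (μ.restrict F) =
      ‖c‖ₑ * localNorm p μ ω (s • E) := by
  rw [eLpNorm_indicator_eq_eLpNorm_restrict hE, Measure.restrict_restrict hE,
    Set.inter_eq_left.2 hEF, localNorm_smul]
  have := eLpNorm_const_smul c (fun t => (ω (s * t) : ℂ)) p (μ.restrict E)
  refine this.trans ?_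
  congr 1
  exact eLpNorm_congr_norm_ae (ae_of_all _ fun t => by simp)

theorem enorm_mul_essSupOn_le (s : G) {c : ℂ} (hc : c ≠ 0)
    {E : Set G} (hE : MeasurableSet E) {r : ℝ} (h : ∀ t ∈ E, ‖c‖ * ω (s * t) ≤ r) :
    ‖c‖ₑ * essSupOn μ ω s E ≤ ENNReal.ofReal r := by
  have hc' := norm_pos_iff.2 hc
  have h1 : essSupOn μ ω s E ≤ ENNReal.ofReal (r / ‖c‖) := by
    refine essSup_le_of_ae_le _ ((ae_restrict_iff' hE).2 (ae_of_all _ fun t ht => ?_))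
    refine ENNReal.ofReal_le_ofReal ?_
    rw [le_div_iff₀' hc']
    exact h t ht
  calc ‖c‖ₑ * essSupOn μ ω s E ≤ ENNReal.ofReal ‖c‖ * ENNReal.ofReal (r / ‖c‖) := by
        rw [ofReal_norm]; gcongr
    _ = ENNReal.ofReal r := by
        rw [← ENNReal.ofReal_mul hc'.le, mul_div_cancel₀ _ hc'.ne']

/-- The set `F` satisfies the condition on essential suprema up to `ε`. -/
def EssSupCondition (Γ : Set ℂ) (S : Set G) (μ : Measure G) (ω : G → ℝ) (F : Set G) (ε : ℝ) :
    Prop :=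
  ∃ s ∈ S, ∃ c ∈ Γ \ {0}, ∃ E : Set G, E ⊆ F ∧ IsCompact E ∧
    μ (F \ E) < ENNReal.ofReal ε ∧
    ‖c‖ₑ * essSupOn μ ω s E < ENNReal.ofReal ε ∧
    ‖c‖ₑ⁻¹ * essSupOn μ ω s⁻¹ E < ENNReal.ofReal ε

/-- The set `F` satisfies the condition on local `p`-norms up to `ε`. -/
def LocalNormCondition (Γ : Set ℂ) (S : Set G) (p : ℝ≥0∞) (μ : Measure G) (ω : G → ℝ) (F : Set G)
    (ε : ℝ) : Prop :=
  ∃ s ∈ S, ∃ c ∈ Γ \ {0}, ∃ E : Set G, E ⊆ F ∧ IsCompact E ∧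
    μ (F \ E) < ENNReal.ofReal ε ∧
    ‖c‖ₑ * localNorm p μ ω (s • E) < ENNReal.ofReal ε ∧
    ‖c‖ₑ⁻¹ * localNorm p μ ω (s⁻¹ • E) < ENNReal.ofReal ε

variable {Γ : Set ℂ} {S : Set G}

theorem LocalNormCondition.mono {F F' : Set G} {ε : ℝ} (hF : IsCompact F) (hFF : F ⊆ F')
    (h : LocalNormCondition Γ S p μ ω F' ε) : LocalNormCondition Γ S p μ ω F ε := by
  obtain ⟨s, hs, c, hc, E, hEF, hE, h1, h2, h3⟩ := h
  have hmono : ∀ r : G, localNorm p μ ω (r • (E ∩ F)) ≤ localNorm p μ ω (r • E) := fun r =>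
    eLpNorm_mono_measure _ (Measure.restrict_mono (Set.smul_set_mono Set.inter_subset_left) le_rfl)
  refine ⟨s, hs, c, hc, E ∩ F, Set.inter_subset_right, hE.inter hF, lt_of_le_of_lt ?_ h1,
    lt_of_le_of_lt ?_ h2, lt_of_le_of_lt ?_ h3⟩
  · exact measure_mono fun t ht => ⟨hFF ht.1, fun h => ht.2 ⟨h, ht.1⟩⟩
  · gcongr; exact hmono _
  · gcongr; exact hmono _

theorem localNormCondition_of_essSupCondition [LocallyCompactSpace G] [IsFiniteMeasureOnCompacts μ]
    (hω : IsWeight p μ ω) {F : Set G}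
    (hF : IsCompact F) (h : ∀ ε : ℝ, 0 < ε → EssSupCondition Γ S μ ω F ε) {ε : ℝ} (hε : 0 < ε) :
    LocalNormCondition Γ S p μ ω F ε := by
  set C := μ F ^ (1 / p.toReal) with hC
  have hCt : C ≠ ∞ := ENNReal.rpow_ne_top_of_nonneg (by positivity) hF.measure_lt_top.ne
  have hC0 : 0 ≤ C.toReal := ENNReal.toReal_nonneg
  -- The `+ 1` covers `C = 0` and keeps the new tolerance at most `ε`.
  have hlt : ENNReal.ofReal (ε / (C.toReal + 1)) * C < ENNReal.ofReal ε := by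
    rw [← ENNReal.ofReal_toReal hCt, ← ENNReal.ofReal_mul (by positivity),
      ENNReal.ofReal_lt_ofReal_iff hε, ENNReal.toReal_ofReal hC0, div_mul_eq_mul_div,
      div_lt_iff₀ (by positivity)]
    nlinarith
  have hle : ε / (C.toReal + 1) ≤ ε := div_le_self hε.le (by linarith)
  obtain ⟨s, hs, c, hc, E, hEF, hE, h1, h2, h3⟩ := h (ε / (C.toReal + 1)) (by positivity)
  have key : ∀ (a : ℝ≥0∞) (r : G), a * essSupOn μ ω r E < ENNReal.ofReal (ε / (C.toReal + 1)) →
      a * localNorm p μ ω (r • E) < ENNReal.ofReal ε := by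
    intro a r har
    refine lt_of_le_of_lt ?_ hlt
    calc a * localNorm p μ ω (r • E) ≤ a * (essSupOn μ ω r E * C) := by
          gcongr; exact hω.localNorm_smul_le r hEF
      _ ≤ _ := by rw [← mul_assoc]; gcongr
  exact ⟨s, hs, c, hc, E, hEF, hE, h1.trans_le (ENNReal.ofReal_le_ofReal hle), key _ _ h2,
    key _ _ h3⟩

theorem essSupCondition_of_localNormCondition [LocallyCompactSpace G] [IsFiniteMeasureOnCompacts μ]
    [μ.InnerRegularCompactLTTop] (hω : IsWeight p μ ω) (hp0 : p ≠ 0) (hp : p ≠ ∞) {F : Set G}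
    (hF : IsCompact F) (h : ∀ ε : ℝ, 0 < ε → LocalNormCondition Γ S p μ ω F ε) {ε : ℝ}
    (hε : 0 < ε) : EssSupCondition Γ S μ ω F ε := by
  have : IsFiniteMeasure (μ.restrict F) := ⟨by simpa using hF.measure_lt_top⟩
  have hε3 : ENNReal.ofReal (ε / 3) ≠ 0 := by simpa using hε
  obtain ⟨δ, hδ, H⟩ := exists_pos_forall_measure_norm_ge_lt
    (Measure.AbsolutelyContinuous.refl (μ.restrict F)) hp0 hp (half_pos hε) hε3
  obtain ⟨r, hr, hrδ⟩ := exists_pos_ofReal_le hδ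
  obtain ⟨s, hs, c, hc, E, hEF, hE, h1, h2, h3⟩ := h (min r (ε / 3)) (lt_min hr (by linarith))
  have hc0 : c ≠ 0 := hc.2
  set g : ℂ → G → G → ℂ := fun b u => E.indicator fun t => b * (ω (u * t) : ℂ) with hg
  have key : ∀ (b : ℂ) (u : G), ‖b‖ₑ * localNorm p μ ω (u • E) < ENNReal.ofReal (min r (ε / 3)) →
      μ (F ∩ {t | ε / 2 ≤ ‖g b u t‖}) < ENNReal.ofReal (ε / 3) := by
    intro b u hb
    have hmeas : AEStronglyMeasurable (g b u) (μ.restrict F) := by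
      refine AEStronglyMeasurable.indicator ?_ hE.measurableSet
      refine AEMeasurable.aestronglyMeasurable (AEMeasurable.restrict ?_)
      exact (Complex.measurable_ofReal.comp_aemeasurable (hω.aemeasurable_mul_left u)).const_mul b
    have := H (g b u) hmeas (by
      rw [enorm_mul_localNorm_smul u b hE.measurableSet hEF]
      exact hb.trans_le ((ENNReal.ofReal_le_ofReal (min_le_left _ _)).trans hrδ))
    rwa [Measure.restrict_apply' hF.measurableSet, Set.inter_comm] at this
  rw [← enorm_inv hc0] at h3
  have k1 := key _ _ h2
  have k2 := key _ _ h3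
  have k3 : μ (F \ E) < ENNReal.ofReal (ε / 3) :=
    h1.trans_le (ENNReal.ofReal_le_ofReal (min_le_right _ _))
  -- Counting `Eᶜ` as exceptional puts `E'` inside `E`, where the indicators in `g` disappear; each
  -- of the three sets costs `ε / 3`.
  obtain ⟨E', hE'F, hE', hdisj, hlt⟩ := exists_isCompact_disjoint μ (N := {t | ε / 2 ≤ ‖g c s t‖} ∪
      {t | ε / 2 ≤ ‖g c⁻¹ s⁻¹ t‖} ∪ Eᶜ) (ε := ENNReal.ofReal ε) hF (by
    rw [Set.inter_union_distrib_left, Set.inter_union_distrib_left]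
    refine (measure_union_le _ _).trans_lt ?_
    refine (add_le_add_left (measure_union_le _ _) _).trans_lt ?_
    refine (ENNReal.add_lt_add (ENNReal.add_lt_add k1 k2) k3).trans_le ?_
    rw [← ENNReal.ofReal_add (by positivity) (by positivity),
      ← ENNReal.ofReal_add (by positivity) (by positivity)]
    exact ENNReal.ofReal_le_ofReal (by linarith))
  have hE'E : E' ⊆ E := fun t ht => by
    by_contra hn
    exact Set.disjoint_left.1 hdisj ht (Or.inr hn)
  have fin : ∀ (b : ℂ) (u : G), b ≠ 0 → (∀ t ∈ E', ‖g b u t‖ ≤ ε / 2) →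
      ‖b‖ₑ * essSupOn μ ω u E' < ENNReal.ofReal ε := by
    intro b u hb hle
    refine (enorm_mul_essSupOn_le u hb hE'.measurableSet (r := ε / 2) fun t ht => ?_).trans_lt
      ((ENNReal.ofReal_lt_ofReal_iff hε).2 (by linarith))
    have := hle t ht
    simpa [hg, Set.indicator_of_mem (hE'E ht), abs_of_pos (hω.pos _)] using this
  refine ⟨s, hs, c, hc, E', hE'F, hE', hlt, fin _ _ hc0 fun t ht => ?_, ?_⟩
  · by_contra hn
    exact Set.disjoint_left.1 hdisj ht (Or.inl (Or.inl (not_le.1 hn).le))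
  · rw [← enorm_inv hc0]
    refine fin _ _ (inv_ne_zero hc0) fun t ht => ?_
    by_contra hn
    exact Set.disjoint_left.1 hdisj ht (Or.inl (Or.inr (not_le.1 hn).le))

/-! ### From approximated indicators to small local norms -/

theorem IsWeight.enorm_mul_localNorm_lt (hω : IsWeight p μ ω) (hp0 : p ≠ 0) (hp : p ≠ ∞)
    {A : Set G} (hA : MeasurableSet A) {c : ℂ} {g : G → ℂ} {ε : ℝ}
    (h : ∀ x ∈ A, ‖c‖ ≤ 2 * ‖g x‖)
    (hg : eLpNorm g p (weightedMeasure p μ ω) < ENNReal.ofReal (ε / 2)) :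
    ‖c‖ₑ * localNorm p μ ω A < ENNReal.ofReal ε := by
  rw [hω.localNorm_eq hp0 hp hA, ← eLpNorm_indicator_const hA hp0 hp]
  calc _ ≤ ENNReal.ofReal 2 * eLpNorm g p (weightedMeasure p μ ω) := by
        refine eLpNorm_le_mul_eLpNorm_of_ae_le_mul (ae_of_all _ fun x => ?_) p
        by_cases hx : x ∈ A
        · simpa [hx] using h x hx
        · simp [hx]
    _ < ENNReal.ofReal 2 * ENNReal.ofReal (ε / 2) :=
        ENNReal.mul_lt_mul_right (by simp) (by simp) hg
    _ = ENNReal.ofReal ε := by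
        rw [← ENNReal.ofReal_mul (by norm_num)]; congr 1; ring

/-- If `sF` met `F₂`, then `s ∈ F₂F⁻¹`, and all points involved would lie in a compact set `B`
independent of `s`, on which both approximations are good off small sets. A good point of `F` gives
`|c| ≤ 7/5`, while a good point of `F₂ \ sF`, available since `F₂` is large, gives `|c| ≥ 5`. -/
theorem exists_compact_of_approx [LocallyCompactSpace G] [IsFiniteMeasureOnCompacts μ]
    [μ.InnerRegularCompactLTTop] (hω : IsWeight p μ ω) (hp0 : p ≠ 0) (hp : p ≠ ∞) {F F₂ : Set G}
    (hF : IsCompact F) (hF₂ : IsCompact F₂) (hFF : F ⊆ F₂) (hF0 : μ F ≠ 0)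
    (hlarge : 3 * μ F < μ F₂) {ε : ℝ} (hε : 0 < ε) :
    ∃ δ > 0, ∀ (h : G → ℂ) (c : ℂ) (s : G),
      AEStronglyMeasurable (fun t => h t - F.indicator 1 t) (weightedMeasure p μ ω) →
      eLpNorm (fun t => h t - F.indicator 1 t) p (weightedMeasure p μ ω) < δ →
      AEStronglyMeasurable (fun t => c * h (s⁻¹ * t) - F₂.indicator 1 t)
        (weightedMeasure p μ ω) →
      eLpNorm (fun t => c * h (s⁻¹ * t) - F₂.indicator 1 t) p (weightedMeasure p μ ω) < δ →
      c ≠ 0 ∧ ∃ E ⊆ F, IsCompact E ∧ μ (F \ E) < ENNReal.ofReal ε ∧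
        ‖c‖ₑ * localNorm p μ ω (s • E) < ENNReal.ofReal ε ∧
        ‖c‖ₑ⁻¹ * localNorm p μ ω (s⁻¹ • E) < ENNReal.ofReal ε := by
  set ν := weightedMeasure p μ ω with hν
  have := hω.isFiniteMeasureOnCompacts hp0 hp
  set B : Set G := F₂ ∪ F * F₂⁻¹ * F₂ ∪ F₂ * F⁻¹ * F with hB
  have hBc : IsCompact B :=
    (hF₂.union ((hF.mul hF₂.inv).mul hF₂)).union ((hF₂.mul hF.inv).mul hF)
  have : IsFiniteMeasure (μ.restrict B) := ⟨by simpa using hBc.measure_lt_top⟩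
  have : SigmaFinite ν := inferInstance
  -- Two exceptional sets of measure below `m` together have measure below `ε` and cannot cover `F`.
  set m : ℝ≥0∞ := min (ENNReal.ofReal (ε / 2)) (μ F / 2 / 2) with hm
  have hFt : μ F ≠ ∞ := hF.measure_lt_top.ne
  have hm0 : m ≠ 0 :=
    (lt_min (by simpa using hε) (ENNReal.half_pos (ENNReal.half_pos hF0).ne')).ne'
  have hm2 : m + m ≤ ENNReal.ofReal ε := by
    calc m + m ≤ ENNReal.ofReal (ε / 2) + ENNReal.ofReal (ε / 2) :=
          add_le_add (min_le_left _ _) (min_le_left _ _)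
      _ = _ := by rw [← ENNReal.ofReal_add (by positivity) (by positivity)]; congr 1; ring
  have hm4 : m + m < μ F := by
    calc m + m ≤ μ F / 2 / 2 + μ F / 2 / 2 := add_le_add (min_le_right _ _) (min_le_right _ _)
      _ = μ F / 2 := ENNReal.add_halves _
      _ < μ F := ENNReal.half_lt_self hF0 hFt
  obtain ⟨δ, hδ, H⟩ := exists_pos_forall_measure_norm_ge_lt (ν := ν) (p := p)
    (Measure.restrict_le_self.absolutelyContinuous.trans hω.absolutelyContinuous :
      μ.restrict B ≪ ν) hp0 hp (η := 1 / 6) (by norm_num) hm0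
  refine ⟨min δ (ENNReal.ofReal (ε / 2)), lt_min hδ (by simpa using hε),
    fun h c s hmeas1 hlt1 hmeas2 hlt2 => ?_⟩
  have hN1 := H _ hmeas1 (hlt1.trans_le (min_le_left _ _))
  have hN2 := H _ hmeas2 (hlt2.trans_le (min_le_left _ _))
  have hg1 := hlt1.trans_le (min_le_right _ _)
  have hg2 := hlt2.trans_le (min_le_right _ _)
  rw [Measure.restrict_apply' hBc.measurableSet] at hN1 hN2
  set N₁ := {t | 1 / 6 ≤ ‖h t - F.indicator 1 t‖} with hN₁
  set N₂ := {t | 1 / 6 ≤ ‖c * h (s⁻¹ * t) - F₂.indicator 1 t‖} with hN₂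
  have hFB : F ⊆ B := fun t ht => Or.inl (Or.inl (hFF ht))
  have hFN1 : μ (F ∩ N₁) < m :=
    (measure_mono fun t ht => ⟨ht.2, hFB ht.1⟩ : μ (F ∩ N₁) ≤ μ (N₁ ∩ B)).trans_lt hN1
  have hFN2 : μ (F ∩ N₂) < m :=
    (measure_mono fun t ht => ⟨ht.2, hFB ht.1⟩ : μ (F ∩ N₂) ≤ μ (N₂ ∩ B)).trans_lt hN2
  have near1 : ∀ t, t ∉ N₁ → t ∈ F → 5 / 6 ≤ ‖h t‖ := by
    intro t ht htF
    simp only [hN₁, Set.mem_ofPred_eq, not_le, Set.indicator_of_mem htF, Pi.one_apply] at ht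
    have := norm_sub_norm_le (1 : ℂ) (1 - h t)
    rw [sub_sub_cancel, norm_one, norm_sub_rev] at this
    linarith
  have far1 : ∀ t, t ∉ N₁ → t ∉ F → ‖h t‖ ≤ 1 / 6 := by
    intro t ht htF
    simp only [hN₁, Set.mem_ofPred_eq, not_le, Set.indicator_of_notMem htF, sub_zero] at ht
    exact ht.le
  have near2 : ∀ t, t ∉ N₂ → t ∈ F₂ → 5 / 6 ≤ ‖c‖ * ‖h (s⁻¹ * t)‖ := by
    intro t ht htF
    simp only [hN₂, Set.mem_ofPred_eq, not_le, Set.indicator_of_mem htF, Pi.one_apply] at ht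
    have := norm_sub_norm_le (1 : ℂ) (1 - c * h (s⁻¹ * t))
    rw [sub_sub_cancel, norm_one, norm_sub_rev, norm_mul] at this
    linarith
  have le2 : ∀ t, t ∉ N₂ → ‖c‖ * ‖h (s⁻¹ * t)‖ ≤ 7 / 6 := by
    intro t ht
    simp only [hN₂, Set.mem_ofPred_eq, not_le] at ht
    have h1 : ‖F₂.indicator (1 : G → ℂ) t‖ ≤ 1 := by
      by_cases h : t ∈ F₂ <;> simp [h]
    have := norm_le_norm_add_norm_sub' (c * h (s⁻¹ * t)) (F₂.indicator (1 : G → ℂ) t)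
    rw [norm_mul] at this
    linarith
  have hc : c ≠ 0 := by
    rintro rfl
    have hne : (F \ N₂).Nonempty := by
      by_contra hn
      rw [Set.not_nonempty_iff_eq_empty, Set.sdiff_eq_empty] at hn
      have : μ F ≤ μ (F ∩ N₂) := measure_mono fun t ht => ⟨ht, hn ht⟩
      exact absurd (this.trans_lt hFN2) (not_lt.2 (le_self_add.trans hm4.le))
    obtain ⟨t, htF, htN⟩ := hne
    have := near2 t htN (hFF htF)
    norm_num at this
  have hdisj : ∀ t ∈ F, s * t ∉ F₂ := by
    intro a haF haF₂
    have hs1 : ∀ x ∈ F₂, s⁻¹ * x ∈ B := fun x hx => by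
      refine Or.inl (Or.inr ⟨a * (s * a)⁻¹, ⟨a, haF, (s * a)⁻¹, Set.inv_mem_inv.2 haF₂, rfl⟩, x,
        hx, ?_⟩)
      simp
    have hs2 : ∀ x ∈ F, s * x ∈ B := fun x hx => by
      refine Or.inr ⟨s * a * a⁻¹, ⟨s * a, haF₂, a⁻¹, Set.inv_mem_inv.2 haF, rfl⟩, x, hx, ?_⟩
      simp
    have hne1 : ∃ t ∈ F, t ∉ N₁ ∧ s * t ∉ N₂ := by
      by_contra! hn
      have hsub : F ⊆ F ∩ N₁ ∪ (fun t => s * t) ⁻¹' (N₂ ∩ B) := fun t ht => by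
        by_cases h1 : t ∈ N₁
        · exact Or.inl ⟨ht, h1⟩
        · exact Or.inr ⟨hn t ht h1, hs2 t ht⟩
      have := (measure_mono (μ := μ) hsub).trans (measure_union_le _ _)
      rw [measure_preimage_mul] at this
      exact absurd (this.trans_lt (ENNReal.add_lt_add hFN1 hN2)) (not_lt.2 hm4.le)
    have hne2 : ∃ x ∈ F₂, x ∉ N₂ ∧ s⁻¹ * x ∉ F ∧ s⁻¹ * x ∉ N₁ := by
      by_contra! hn
      have hsub : F₂ ⊆ N₂ ∩ B ∪ (fun t => s⁻¹ * t) ⁻¹' F ∪ (fun t => s⁻¹ * t) ⁻¹' (N₁ ∩ B) :=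
        fun t ht => by
          by_cases h1 : t ∈ N₂
          · exact Or.inl (Or.inl ⟨h1, Or.inl (Or.inl ht)⟩)
          by_cases h2 : s⁻¹ * t ∈ F
          · exact Or.inl (Or.inr h2)
          · exact Or.inr ⟨hn t ht h1 h2, hs1 t ht⟩
      have := (measure_mono (μ := μ) hsub).trans ((measure_union_le _ _).trans
        (add_le_add_left (measure_union_le _ _) _))
      rw [measure_preimage_mul, measure_preimage_mul] at this
      have h3 : μ F₂ ≤ 3 * μ F := by
        calc μ F₂ ≤ m + μ F + m := this.trans (by gcongr)
          _ = m + m + μ F := by ring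
          _ ≤ μ F + μ F := by gcongr
          _ ≤ 3 * μ F := by rw [← two_mul]; gcongr; norm_num
      exact absurd hlarge (not_lt.2 h3)
    obtain ⟨t, htF, ht1, ht2⟩ := hne1
    obtain ⟨x, hxF, hx2, hx1, hx3⟩ := hne2
    have e1 := near1 t ht1 htF
    have e2 := le2 _ ht2
    rw [inv_mul_cancel_left] at e2
    have e3 := near2 x hx2 hxF
    have e4 := far1 _ hx3 hx1
    have hc' := norm_pos_iff.2 hc
    -- `e1`, `e2` give `5/6 |c| ≤ 7/6`; `e3`, `e4` give `5/6 ≤ |c|/6`.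
    nlinarith
  obtain ⟨E, hEF, hE, hEN, hlt⟩ := exists_isCompact_disjoint μ (N := N₁ ∪ N₂)
    (ε := ENNReal.ofReal ε) hF (by
      rw [Set.inter_union_distrib_left]
      exact ((measure_union_le _ _).trans_lt (ENNReal.add_lt_add hFN1 hFN2)).trans_le hm2)
  have hE1 : ∀ t ∈ E, t ∉ N₁ := fun t ht h => Set.disjoint_left.1 hEN ht (Or.inl h)
  have hE2 : ∀ t ∈ E, t ∉ N₂ := fun t ht h => Set.disjoint_left.1 hEN ht (Or.inr h)
  refine ⟨hc, E, hEF, hE, hlt, ?_, ?_⟩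
  · refine hω.enorm_mul_localNorm_lt hp0 hp (hE.smul s).measurableSet ?_ hg2
    rintro _ ⟨t, ht, rfl⟩
    have e := near1 t (hE1 t ht) (hEF ht)
    simp only [smul_eq_mul, Set.indicator_of_notMem (hdisj t (hEF ht)), sub_zero, norm_mul,
      inv_mul_cancel_left]
    nlinarith [norm_nonneg c]
  · rw [← enorm_inv hc]
    refine hω.enorm_mul_localNorm_lt hp0 hp (hE.smul s⁻¹).measurableSet ?_ hg1
    rintro _ ⟨t, ht, rfl⟩
    have e := near2 t (hE2 t ht) (hFF (hEF ht))
    have hn : s⁻¹ * t ∉ F := fun h => hdisj _ h (by simpa using hFF (hEF ht))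
    simp only [smul_eq_mul, Set.indicator_of_notMem hn, sub_zero, norm_inv]
    rw [inv_le_iff_one_le_mul₀ (norm_pos_iff.2 hc)]
    nlinarith

end Conditions

/-- Birkhoff's transitivity argument: for each basic open `V`, the points whose orbit meets `V` form
a dense open set. -/
theorem exists_dense_range_of_transitive {ι X Y : Type*} [TopologicalSpace X] [BaireSpace X]
    [Nonempty X] [TopologicalSpace Y] [SecondCountableTopology Y] (Φ : ι → X → Y)
    (hΦ : ∀ i, Continuous (Φ i))
    (h : ∀ (U : Set X) (V : Set Y), IsOpen U → IsOpen V → U.Nonempty → V.Nonempty →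
      ∃ i, ∃ x ∈ U, Φ i x ∈ V) :
    ∃ x, Dense (Set.range fun i => Φ i x) := by
  have hd : Dense (⋂ V ∈ TopologicalSpace.countableBasis Y, ⋃ i, Φ i ⁻¹' V) := by
    refine dense_biInter_of_isOpen (fun V hV => ?_) (TopologicalSpace.countable_countableBasis Y)
      fun V hV => ?_
    · exact isOpen_iUnion fun i => (TopologicalSpace.isOpen_of_mem_countableBasis hV).preimage (hΦ i)
    · refine dense_iff_inter_open.2 fun U hU hUn => ?_
      obtain ⟨i, x, hx, hi⟩ := h U V hU (TopologicalSpace.isOpen_of_mem_countableBasis hV) hUn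
        (TopologicalSpace.nonempty_of_mem_countableBasis hV)
      exact ⟨x, hx, Set.mem_iUnion.2 ⟨i, hi⟩⟩
  obtain ⟨x, hx⟩ := hd.nonempty
  refine ⟨x, (TopologicalSpace.isBasis_countableBasis Y).dense_iff.2 fun V hV _ => ?_⟩
  obtain ⟨i, hi⟩ := Set.mem_iUnion.1 (Set.mem_iInter₂.1 hx V hV)
  exact ⟨Φ i x, hi, i, rfl⟩

/-! ### From a dense vector to the local norm condition -/

section Operators

variable {G : Type*} [Group G] [TopologicalSpace G] [MeasurableSpace G]
  {μ : Measure G} {p : ℝ≥0∞} {ω : G → ℝ} [BorelSpace G] [T2Space G]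
  [IsTopologicalGroup G] [SecondCountableTopology G] [LocallyCompactSpace G]
  [μ.IsMulLeftInvariant] {Γ : Set ℂ} {S : Set G}

theorem orbit_eq_range [Fact (1 ≤ p)] (hω : IsWeight p μ ω)
    {T : S → WeightedLp p μ ω →L[ℂ] WeightedLp p μ ω}
    (hT : ∀ s f, T s f =ᵐ[μ] translate (s : G) f) (f : WeightedLp p μ ω) :
    orbit Γ S p μ ω f = Set.range fun i : Γ × S => (i.1 : ℂ) • T i.2 f := by
  have key : ∀ (c : ℂ) (s : S), ((c • T s f : WeightedLp p μ ω) : G → ℂ) =ᵐ[μ]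
      fun t => c * translate (s : G) f t := fun c s => by
    filter_upwards [hω.ae_eq_iff.2 (Lp.coeFn_smul c (T s f)), hT s f] with t h1 h2
    rw [h1, Pi.smul_apply, h2, smul_eq_mul]
  ext h
  constructor
  · rintro ⟨c, hc, s, hs, hh⟩
    exact ⟨(⟨c, hc⟩, ⟨s, hs⟩), Lp.ext (hω.ae_eq_iff.1 ((key c ⟨s, hs⟩).trans hh.symm))⟩
  · rintro ⟨⟨⟨c, hc⟩, ⟨s, hs⟩⟩, rfl⟩
    exact ⟨c, hc, s, hs, key c ⟨s, hs⟩⟩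

theorem memLp_indicator_one (hp0 : p ≠ 0) (hp : p ≠ ∞) (hω : IsWeight p μ ω) {K : Set G}
    (hK : IsCompact K) :
    MemLp (K.indicator (1 : G → ℂ)) p (weightedMeasure p μ ω) := by
  have := hω.isFiniteMeasureOnCompacts hp0 hp
  exact memLp_indicator_const p hK.measurableSet 1 (Or.inr hK.measure_lt_top.ne)

/-- Take `h = b T_r f` close to `u` and write `v = T_r v'`. If `c T_s f` is close enough to `b⁻¹
v'`, applying `b T_r` and commuting it past `T_s` brings `c T_s h` close to `v`. -/
theorem exists_approx_of_dense [Fact (1 ≤ p)] (hω : IsWeight p μ ω)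
    {T : S → WeightedLp p μ ω →L[ℂ] WeightedLp p μ ω}
    (hT : ∀ s f, T s f =ᵐ[μ] translate (s : G) f)
    (hab : ∀ x ∈ S, ∀ y ∈ S, x * y = y * x)
    {f : WeightedLp p μ ω} (hf : IsDenseVector Γ S p μ ω f) {u v : WeightedLp p μ ω} (hu : u ≠ 0)
    (hv : ∀ s, v ∈ Set.range (T s)) {δ : ℝ} (hδ : 0 < δ) :
    ∃ h, ∃ c ∈ Γ, ∃ s, ‖h - u‖ < δ ∧ ‖c • T s h - v‖ < δ := by
  rw [IsDenseVector, orbit_eq_range hω hT] at hf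
  -- A radius of at most `‖u‖` keeps `0` out of the ball, so that `b ≠ 0` even if `0 ∈ Γ`.
  obtain ⟨_, ⟨⟨⟨b, hb⟩, r⟩, rfl⟩, hh⟩ := hf.exists_mem_open
    (Metric.isOpen_ball (x := u) (ε := min δ ‖u‖))
    ⟨u, Metric.mem_ball_self (lt_min hδ (norm_pos_iff.2 hu))⟩
  simp only [mem_ball_iff_norm, lt_min_iff] at hh
  have hb0 : b ≠ 0 := by
    rintro rfl
    simp at hh
  obtain ⟨v', rfl⟩ := hv r
  have hcont : Continuous fun x => b • T r x := by fun_prop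
  obtain ⟨_, ⟨⟨⟨c, hc⟩, s⟩, rfl⟩, hx⟩ := hf.exists_mem_open
    ((Metric.isOpen_ball (x := T r v') (ε := δ)).preimage hcont)
    ⟨b⁻¹ • v', by simp [smul_smul, hb0, hδ]⟩
  refine ⟨b • T r f, c, hc, s, hh.1, ?_⟩
  have hcomm : T s (T r f) = T r (T s f) := by
    refine Lp.ext (hω.ae_eq_iff.1 ?_)
    filter_upwards [hT s (T r f), hT r (T s f), translate_congr (s := (s : G)) (hT r f),
      translate_congr (s := (r : G)) (hT s f)] with t h1 h2 h3 h4
    rw [h1, h2, h3, h4]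
    simp only [translate, ← mul_assoc, ← mul_inv_rev, hab _ r.2 _ s.2]
  simp only [Set.mem_preimage, mem_ball_iff_norm, map_smul] at hx
  rwa [map_smul, hcomm, smul_comm]

theorem localNormCondition_of_dense [NoncompactSpace G] [μ.IsOpenPosMeasure] [μ.Regular]
    [Fact (1 ≤ p)] (hp : p ≠ ∞)
    (hω : IsWeight p μ ω) {T : S → WeightedLp p μ ω →L[ℂ] WeightedLp p μ ω}
    (hT : ∀ s f, T s f =ᵐ[μ] translate (s : G) f)
    (hab : ∀ x ∈ S, ∀ y ∈ S, x * y = y * x)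
    {f : WeightedLp p μ ω} (hf : IsDenseVector Γ S p μ ω f) {F : Set G} (hF : IsCompact F) {ε : ℝ}
    (hε : 0 < ε) : LocalNormCondition Γ S p μ ω F ε := by
  have hp0 : p ≠ 0 := (zero_lt_one.trans_le (Fact.out : 1 ≤ p)).ne'
  -- A null `F` is enlarged by a compact neighbourhood of `1`.
  wlog hF0 : μ F ≠ 0 generalizing F
  · obtain ⟨K, hK, hK1⟩ := exists_compact_mem_nhds (1 : G)
    exact (this (hF.union hK) ((Measure.measure_pos_of_mem_nhds μ hK1).trans_le
      (measure_mono Set.subset_union_right)).ne').mono hF Set.subset_union_left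
  obtain ⟨K, -, hK, hlt⟩ := isOpen_univ.exists_lt_isCompact (μ := μ) (r := 3 * μ F) (by
    rw [measure_univ_of_isMulLeftInvariant]
    exact ENNReal.mul_lt_top (by simp) hF.measure_lt_top)
  obtain ⟨δ, hδ, H⟩ := exists_compact_of_approx hω hp0 hp hF (hK.union hF) Set.subset_union_right
    hF0 (hlt.trans_le (measure_mono Set.subset_union_left)) hε
  obtain ⟨r, hr, hrδ⟩ := exists_pos_ofReal_le hδ
  have mem := fun (A : Set G) (hA : IsCompact A) => memLp_indicator_one hp0 hp hω hA
  have hco : ∀ A (hA : IsCompact A), (mem A hA).toLp =ᵐ[μ] A.indicator 1 := fun A hA =>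
    hω.ae_eq_iff.2 (MemLp.coeFn_toLp _)
  have hu : (mem F hF).toLp ≠ 0 := by
    intro h0
    have h1 := (hco F hF).symm.trans (h0 ▸ hω.ae_eq_iff.2 (Lp.coeFn_zero ℂ p _))
    rw [Set.indicator_ae_eq_zero] at h1
    simp [Function.support, hF0] at h1
  -- Here `s⁻¹` need not be admissible; the preimage is the indicator of the compact set `s⁻¹(K ∪
  -- F)`, which lies in the space by local integrability of `ω`.
  have hv : ∀ s : S, (mem _ (hK.union hF)).toLp ∈ Set.range (T s) := by
    intro s
    have hiff : ∀ t, (s : G)⁻¹ * t ∈ (s : G)⁻¹ • (K ∪ F) ↔ t ∈ K ∪ F := fun t => by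
      rw [← smul_eq_mul, Set.smul_mem_smul_set_iff]
    have htr : translate (s : G) (((s : G)⁻¹ • (K ∪ F)).indicator 1) = (K ∪ F).indicator 1 := by
      ext t
      by_cases ht : t ∈ K ∪ F
      · simp only [translate, Set.indicator_of_mem ht, Set.indicator_of_mem ((hiff t).2 ht),
          Pi.one_apply]
      · simp only [translate, Set.indicator_of_notMem ht,
          Set.indicator_of_notMem (mt (hiff t).1 ht)]
    have hc := translate_congr (s := (s : G)) (hco _ ((hK.union hF).smul (s : G)⁻¹))
    rw [htr] at hc
    exact ⟨_, Lp.ext (hω.ae_eq_iff.1 (((hT s _).trans hc).trans (hco _ (hK.union hF)).symm))⟩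
  obtain ⟨h, c, hc, s, h1, h2⟩ := exists_approx_of_dense hω hT hab hf hu hv hr
  have e1 : ((h - (mem F hF).toLp : WeightedLp p μ ω) : G → ℂ) =ᵐ[weightedMeasure p μ ω]
      fun t => h t - F.indicator 1 t := by
    filter_upwards [Lp.coeFn_sub h (mem F hF).toLp, (mem F hF).coeFn_toLp] with t a b
    rw [a, Pi.sub_apply, b]
  have e2 : ((c • T s h - (mem _ (hK.union hF)).toLp : WeightedLp p μ ω) : G → ℂ)
      =ᵐ[weightedMeasure p μ ω] fun t => c * h ((s : G)⁻¹ * t) - (K ∪ F).indicator 1 t := by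
    filter_upwards [Lp.coeFn_sub (c • T s h) (mem _ (hK.union hF)).toLp, Lp.coeFn_smul c (T s h),
      (mem _ (hK.union hF)).coeFn_toLp, hω.ae_eq_iff.1 (hT s h)] with t a b d e
    rw [a, Pi.sub_apply, b, d, Pi.smul_apply, e]
    rfl
  have small : ∀ x : WeightedLp p μ ω, ‖x‖ < r → eLpNorm x p (weightedMeasure p μ ω) < δ := by
    intro x hx
    rw [← Lp.enorm_def, ← ofReal_norm]
    exact ((ENNReal.ofReal_lt_ofReal_iff hr).2 hx).trans_le hrδ
  obtain ⟨hc0, E, hE⟩ := H h c s ((Lp.aestronglyMeasurable _).congr e1)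
    (by rw [← eLpNorm_congr_ae e1]; exact small _ h1) ((Lp.aestronglyMeasurable _).congr e2)
    (by rw [← eLpNorm_congr_ae e2]; exact small _ h2)
  exact ⟨s, s.2, c, ⟨hc, hc0⟩, E, hE⟩

/-! ### From the local norm condition to a dense vector -/

theorem IsWeight.eLpNorm_le_localNorm (hω : IsWeight p μ ω) (hp0 : p ≠ 0) (hp : p ≠ ∞)
    {A : Set G} (hA : MeasurableSet A) {g : G → ℂ} {C : ℝ} (hC : 0 ≤ C) (h : ∀ x, ‖g x‖ ≤ C)
    (h0 : ∀ x ∉ A, g x = 0) :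
    eLpNorm g p (weightedMeasure p μ ω) ≤ ENNReal.ofReal C * localNorm p μ ω A := by
  rw [hω.localNorm_eq hp0 hp hA]
  have := eLpNorm_indicator_const (μ := weightedMeasure p μ ω) (c := C) hA hp0 hp
  rw [Real.enorm_of_nonneg hC] at this
  rw [← this]
  refine eLpNorm_mono fun x => ?_
  by_cases hx : x ∈ A
  · simpa [hx, abs_of_nonneg hC] using h x
  · simp [hx, h0 x hx]

theorem exists_localNorm_diff_lt [IsFiniteMeasureOnCompacts μ] (hω : IsWeight p μ ω) (hp0 : p ≠ 0)
    (hp : p ≠ ∞)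
    {F : Set G} (hF : IsCompact F) {δ : ℝ≥0∞} (hδ : 0 < δ) : ∃ η > 0, ∀ E ⊆ F, IsCompact E →
      μ (F \ E) < η → localNorm p μ ω (F \ E) < δ := by
  have hpp := ENNReal.toReal_pos hp0 hp
  have := hω.isFiniteMeasureOnCompacts hp0 hp
  have : IsFiniteMeasure ((weightedMeasure p μ ω).restrict F) :=
    ⟨by simpa using hF.measure_lt_top⟩
  obtain ⟨η, hη, H⟩ := exists_pos_forall_measure_lt
    (Measure.restrict_le_self.absolutelyContinuous.trans weightedMeasure_absolutelyContinuous :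
      (weightedMeasure p μ ω).restrict F ≪ μ) (ε := δ ^ p.toReal)
    (ENNReal.rpow_pos_of_nonneg hδ hpp.le).ne'
  refine ⟨η, hη, fun E _ hE h => ?_⟩
  have := H _ h
  rw [Measure.restrict_apply' hF.measurableSet, Set.inter_eq_left.2 Set.sdiff_subset] at this
  rw [hω.localNorm_eq hp0 hp (hF.measurableSet.diff hE.measurableSet), one_div,
    ENNReal.rpow_inv_lt_iff hpp]
  exact this

/-- The translations by elements of `S` and scalars in `Γ` act transitively. -/
theorem exists_approx_of_localNormCondition [IsFiniteMeasureOnCompacts μ] [Fact (1 ≤ p)]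
    (hp : p ≠ ∞) (hω : IsWeight p μ ω) {T : S → WeightedLp p μ ω →L[ℂ] WeightedLp p μ ω}
    (hT : ∀ s f, T s f =ᵐ[μ] translate (s : G) f)
    (H : ∀ F : Set G, IsCompact F → ∀ ε : ℝ, 0 < ε → LocalNormCondition Γ S p μ ω F ε)
    (u v : WeightedLp p μ ω) {δ : ℝ} (hδ : 0 < δ) :
    ∃ h, ∃ c ∈ Γ, ∃ s, ‖h - u‖ < δ ∧ ‖c • T s h - v‖ < δ := by
  have hp0 : p ≠ 0 := (zero_lt_one.trans_le (Fact.out : 1 ≤ p)).ne'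
  set ν := weightedMeasure p μ ω with hν
  have := hω.isFiniteMeasureOnCompacts hp0 hp
  have hδ4 : ENNReal.ofReal (δ / 4) ≠ 0 := by simpa using hδ
  obtain ⟨u', hus, hu, huc, hum⟩ :=
    (Lp.memLp u).exists_hasCompactSupport_eLpNorm_sub_le hp hδ4
  obtain ⟨v', hvs, hv, hvc, hvm⟩ :=
    (Lp.memLp v).exists_hasCompactSupport_eLpNorm_sub_le hp hδ4
  obtain ⟨Cu, hCu⟩ := hus.exists_bound_of_continuous huc
  obtain ⟨Cv, hCv⟩ := hvs.exists_bound_of_continuous hvc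
  set C := max 1 (max Cu Cv) with hC
  have hC0 : 0 < C := zero_lt_one.trans_le (le_max_left _ _)
  have hu_le : ∀ x, ‖u' x‖ ≤ C := fun x => (hCu x).trans ((le_max_left _ _).trans (le_max_right _ _))
  have hv_le : ∀ x, ‖v' x‖ ≤ C := fun x => (hCv x).trans ((le_max_right _ _).trans (le_max_right _ _))
  set F := tsupport u' ∪ tsupport v' with hF
  have hFc : IsCompact F := IsCompact.union hus hvs
  have hu0 : ∀ x ∉ F, u' x = 0 := fun x hx => image_eq_zero_of_notMem_tsupport fun h => hx (Or.inl h)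
  have hv0 : ∀ x ∉ F, v' x = 0 := fun x hx => image_eq_zero_of_notMem_tsupport fun h => hx (Or.inr h)
  have hδC : 0 < δ / 4 / C := by positivity
  obtain ⟨η, hη, hηF⟩ := exists_localNorm_diff_lt hω hp0 hp hFc (δ := ENNReal.ofReal (δ / 4 / C))
    (by simpa using hδC)
  obtain ⟨r, hr, hrη⟩ := exists_pos_ofReal_le hη
  obtain ⟨s, hs, c, ⟨hc, hc0⟩, E, hEF, hE, h1, h2, h3⟩ := H F hFc (min r (δ / 4 / C)) (lt_min hr hδC)
  have hc0 : c ≠ 0 := hc0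
  have hFE := hηF E hEF hE
    (h1.trans_le ((ENNReal.ofReal_le_ofReal (min_le_left _ _)).trans hrη))
  replace h2 := h2.trans_le (ENNReal.ofReal_le_ofReal (min_le_right _ _))
  replace h3 := h3.trans_le (ENNReal.ofReal_le_ofReal (min_le_right _ _))
  have hmul : ∀ x : ℝ≥0∞, x < ENNReal.ofReal (δ / 4 / C) →
      ENNReal.ofReal C * x < ENNReal.ofReal (δ / 4) := fun x hx => by
    refine (ENNReal.mul_lt_mul_right (by simpa using hC0) (by simp) hx).trans_le ?_
    rw [← ENNReal.ofReal_mul hC0.le, mul_div_cancel₀ _ hC0.ne']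
  have hmulc : ∀ (b : ℂ) (x : ℝ≥0∞), ‖b‖ₑ * x < ENNReal.ofReal (δ / 4 / C) →
      ENNReal.ofReal (‖b‖ * C) * x < ENNReal.ofReal (δ / 4) := fun b x hx => by
    rw [ENNReal.ofReal_mul (norm_nonneg _), ofReal_norm, mul_comm ‖b‖ₑ, mul_assoc]
    exact hmul _ hx
  -- the four error terms
  have trunc : ∀ g : G → ℂ, (∀ x, ‖g x‖ ≤ C) → (∀ x ∉ F, g x = 0) →
      eLpNorm (E.indicator g - g) p ν < ENNReal.ofReal (δ / 4) := fun g hg hg0 => by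
    refine (hω.eLpNorm_le_localNorm hp0 hp (hFc.measurableSet.diff hE.measurableSet) hC0.le
      (fun x => ?_) fun x hx => ?_).trans_lt (hmul _ hFE)
    · by_cases hx : x ∈ E
      · simpa [hx] using hC0.le
      · simpa [hx] using hg x
    · by_cases hxE : x ∈ E
      · simp [hxE]
      · have hxF : x ∉ F := fun h => hx ⟨h, hxE⟩
        simp [hxE, hg0 x hxF]
  have shift : ∀ (b : ℂ) (a : G) (g : G → ℂ), (∀ x, ‖g x‖ ≤ C) →
      ‖b‖ₑ * localNorm p μ ω (a • E) < ENNReal.ofReal (δ / 4 / C) →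
      eLpNorm (fun t => b * translate a (E.indicator g) t) p ν < ENNReal.ofReal (δ / 4) :=
    fun b a g hg hlt => by
      refine (hω.eLpNorm_le_localNorm hp0 hp (hE.smul a).measurableSet
        (C := ‖b‖ * C) (by positivity) (fun x => ?_) fun x hx => ?_).trans_lt (hmulc _ _ hlt)
      · rw [norm_mul]
        gcongr
        exact (norm_indicator_le_norm_self _ _).trans (hg _)
      · have : a⁻¹ * x ∉ E := by rwa [← smul_eq_mul, ← Set.mem_smul_set_iff_inv_smul_mem]
        simp [translate, this]
  have huE : MemLp (E.indicator u') p ν := hum.indicator hE.measurableSet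
  have hvE : MemLp (E.indicator v') p ν := hvm.indicator hE.measurableSet
  rw [← enorm_inv hc0] at h3
  -- There may be no operator `T_{s⁻¹}`, so membership is read off from the bound on `s⁻¹E`.
  have hz : MemLp (fun t => c⁻¹ * translate s⁻¹ (E.indicator v') t) p ν := by
    refine ⟨?_, (shift c⁻¹ s⁻¹ v' hv_le h3).trans ENNReal.ofReal_lt_top⟩
    have : Measurable (E.indicator v') := hvc.measurable.indicator hE.measurableSet
    exact ((this.comp (measurable_const_mul _)).const_mul _).aestronglyMeasurable
  have norm_lt : ∀ {x : WeightedLp p μ ω} {g : G → ℂ}, x =ᵐ[ν] g →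
      eLpNorm g p ν < ENNReal.ofReal (δ / 4) → ‖x‖ < δ / 4 := fun {x g} hxg hg => by
    rw [← eLpNorm_congr_ae hxg, ← Lp.enorm_def, ← ofReal_norm,
      ENNReal.ofReal_lt_ofReal_iff (by positivity)] at hg
    exact hg
  have norm_le : ∀ {x : WeightedLp p μ ω} {g : G → ℂ}, x =ᵐ[ν] g →
      eLpNorm g p ν ≤ ENNReal.ofReal (δ / 4) → ‖x‖ ≤ δ / 4 := fun {x g} hxg hg => by
    rw [← eLpNorm_congr_ae hxg, ← Lp.enorm_def, ← ofReal_norm,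
      ENNReal.ofReal_le_ofReal_iff (by positivity)] at hg
    exact hg
  have a1 : ‖u - hum.toLp‖ ≤ δ / 4 :=
    norm_le ((Lp.coeFn_sub _ _).trans (ae_eq_rfl.sub hum.coeFn_toLp)) hu
  have a2 : ‖v - hvm.toLp‖ ≤ δ / 4 :=
    norm_le ((Lp.coeFn_sub _ _).trans (ae_eq_rfl.sub hvm.coeFn_toLp)) hv
  have a3 : ‖huE.toLp - hum.toLp‖ < δ / 4 :=
    norm_lt ((Lp.coeFn_sub _ _).trans (huE.coeFn_toLp.sub hum.coeFn_toLp)) (trunc u' hu_le hu0)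
  have a4 : ‖hvE.toLp - hvm.toLp‖ < δ / 4 :=
    norm_lt ((Lp.coeFn_sub _ _).trans (hvE.coeFn_toLp.sub hvm.coeFn_toLp)) (trunc v' hv_le hv0)
  have a5 : ‖hz.toLp‖ < δ / 4 := norm_lt hz.coeFn_toLp (shift _ _ v' hv_le h3)
  have a6 : ‖c • T ⟨s, hs⟩ huE.toLp‖ < δ / 4 := by
    refine norm_lt ?_ (shift _ _ u' hu_le h2)
    filter_upwards [Lp.coeFn_smul c (T ⟨s, hs⟩ huE.toLp), hω.ae_eq_iff.1 (hT ⟨s, hs⟩ huE.toLp),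
      hω.ae_eq_iff.1 (translate_congr (s := s) (hω.ae_eq_iff.2 huE.coeFn_toLp))] with t b1 b2 b3
    rw [b1, Pi.smul_apply, b2, b3, smul_eq_mul]
  have a7 : c • T ⟨s, hs⟩ hz.toLp = hvE.toLp := by
    refine Lp.ext ?_
    filter_upwards [Lp.coeFn_smul c (T ⟨s, hs⟩ hz.toLp), hω.ae_eq_iff.1 (hT ⟨s, hs⟩ hz.toLp),
      hω.ae_eq_iff.1 (translate_congr (s := s) (hω.ae_eq_iff.2 hz.coeFn_toLp)),
      hvE.coeFn_toLp] with t b1 b2 b3 b4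
    rw [b1, Pi.smul_apply, b2, b3, b4, smul_eq_mul]
    simp [translate, hc0]
  refine ⟨huE.toLp + hz.toLp, c, hc, ⟨s, hs⟩, ?_, ?_⟩
  · calc _ = ‖(huE.toLp - hum.toLp) - (u - hum.toLp) + hz.toLp‖ := by congr 1; abel
      _ ≤ ‖huE.toLp - hum.toLp‖ + ‖u - hum.toLp‖ + ‖hz.toLp‖ :=
          (norm_add_le _ _).trans (add_le_add_left (norm_sub_le _ _) _)
      _ < δ := by linarith
  · rw [map_add, smul_add, a7]
    calc _ = ‖(hvE.toLp - hvm.toLp) - (v - hvm.toLp) + c • T ⟨s, hs⟩ huE.toLp‖ := by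
          congr 1; abel
      _ ≤ ‖hvE.toLp - hvm.toLp‖ + ‖v - hvm.toLp‖ + ‖c • T ⟨s, hs⟩ huE.toLp‖ :=
          (norm_add_le _ _).trans (add_le_add_left (norm_sub_le _ _) _)
      _ < δ := by linarith

theorem exists_isDenseVector [IsFiniteMeasureOnCompacts μ] [Fact (1 ≤ p)]
    (hp : p ≠ ∞) (hω : IsWeight p μ ω) {T : S → WeightedLp p μ ω →L[ℂ] WeightedLp p μ ω}
    (hT : ∀ s f, T s f =ᵐ[μ] translate (s : G) f)
    (H : ∀ F : Set G, IsCompact F → ∀ ε : ℝ, 0 < ε → LocalNormCondition Γ S p μ ω F ε) :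
    ∃ f, IsDenseVector Γ S p μ ω f := by
  have hp0 : p ≠ 0 := (zero_lt_one.trans_le (Fact.out : 1 ≤ p)).ne'
  have := hω.isFiniteMeasureOnCompacts hp0 hp
  -- Makes the second countability of the `L^p` space available to instance search.
  have : Fact (p ≠ ∞) := ⟨hp⟩
  obtain ⟨f, hf⟩ := exists_dense_range_of_transitive
    (fun (i : Γ × S) (x : WeightedLp p μ ω) => (i.1 : ℂ) • T i.2 x) (fun i => by fun_prop)
    fun U V hU hV ⟨u, hu⟩ ⟨v, hv⟩ => by
      obtain ⟨δ₁, hδ₁, hU'⟩ := Metric.isOpen_iff.1 hU u hu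
      obtain ⟨δ₂, hδ₂, hV'⟩ := Metric.isOpen_iff.1 hV v hv
      obtain ⟨h, c, hc, s, h1, h2⟩ :=
        exists_approx_of_localNormCondition hp hω hT H u v (lt_min hδ₁ hδ₂)
      exact ⟨(⟨c, hc⟩, s), h, hU' (mem_ball_iff_norm.2 (h1.trans_le (min_le_left _ _))),
        hV' (mem_ball_iff_norm.2 (h2.trans_le (min_le_right _ _)))⟩
  exact ⟨f, by rwa [IsDenseVector, orbit_eq_range hω hT]⟩

end Operators

end WeightedGroup

theorem theoremB {G : Type*} [Group G] [TopologicalSpace G] [IsTopologicalGroup G] [T2Space G]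
    [LocallyCompactSpace G] [SecondCountableTopology G] [NoncompactSpace G]
    [MeasurableSpace G] [BorelSpace G] (μ : Measure G) [μ.IsHaarMeasure]
    (S : Set G) (p : ℝ≥0∞) [Fact (1 ≤ p)] (hp : p ≠ ∞)
    (Γ : Set ℂ) (hΓ : (Γ \ {0}).Nonempty)
    (ω : G → ℝ) (hω : WeightedGroup.IsWeight p μ ω) (hS : WeightedGroup.IsAdmissible μ S ω)
    (hab : ∀ x ∈ Subgroup.closure S, ∀ y ∈ Subgroup.closure S, x * y = y * x) :
    List.TFAE [
      ∃ f : WeightedGroup.WeightedLp p μ ω, WeightedGroup.IsDenseVector Γ S p μ ω f,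
      ∀ F : Set G, IsCompact F → ∀ ε : ℝ, 0 < ε →
        ∃ s ∈ S, ∃ c ∈ Γ \ {0}, ∃ E : Set G, E ⊆ F ∧ IsCompact E ∧
          μ (F \ E) < ENNReal.ofReal ε ∧
          ‖c‖ₑ * WeightedGroup.essSupOn μ ω s E < ENNReal.ofReal ε ∧
          ‖c‖ₑ⁻¹ * WeightedGroup.essSupOn μ ω s⁻¹ E < ENNReal.ofReal ε,
      ∀ F : Set G, IsCompact F → ∀ ε : ℝ, 0 < ε →
        ∃ s ∈ S, ∃ c ∈ Γ \ {0}, ∃ E : Set G, E ⊆ F ∧ IsCompact E ∧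
          μ (F \ E) < ENNReal.ofReal ε ∧
          ‖c‖ₑ * WeightedGroup.localNorm p μ ω (s • E) < ENNReal.ofReal ε ∧
          ‖c‖ₑ⁻¹ * WeightedGroup.localNorm p μ ω (s⁻¹ • E) < ENNReal.ofReal ε] := by
  have hp0 : p ≠ 0 := (zero_lt_one.trans_le (Fact.out : 1 ≤ p)).ne'
  have hT : ∀ s : S, ∃ T : WeightedGroup.WeightedLp p μ ω →L[ℂ] WeightedGroup.WeightedLp p μ ω,
      ∀ f, T f =ᵐ[μ] WeightedGroup.translate (s : G) f := fun s =>
    WeightedGroup.exists_translateCLM hp hω (hS s s.2)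
  choose T hT using hT
  tfae_have 1 → 3 := fun ⟨f, hf⟩ F hF ε hε =>
    WeightedGroup.localNormCondition_of_dense hp hω hT
      (fun x hx y hy => hab x (Subgroup.subset_closure hx) y (Subgroup.subset_closure hy)) hf hF hε
  tfae_have 3 → 1 := fun H => WeightedGroup.exists_isDenseVector hp hω hT H
  tfae_have 2 → 3 := fun H F hF ε hε =>
    WeightedGroup.localNormCondition_of_essSupCondition hω hF (H F hF) hε
  tfae_have 3 → 2 := fun H F hF ε hε =>
    WeightedGroup.essSupCondition_of_localNormCondition hω hp0 hp hF (H F hF) hε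
  tfae_finish
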